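/- Let $d,k,L\ge 1$ be integers, let $\tau\in\mathbb{R}$, and let $u_1,\dots,u_k\in\mathbb{R}^d$ be vectors with Euclidean norm $\|u_i\|=1$ for all $i$ and $|u_i^Tu_j|<\tau$ for all $i\ne j$. Let $\eta>0$ and put $$A_1(L,\eta)=\tfrac12\sqrt{\log L}-\sqrt{2\log\tfrac{12}{\eta}},\qquad C_1(\eta,d)=\sqrt{3\log(3/\eta)\,d+2\log(3/\eta)},$$ $$B_1(L,\eta,\tau)=\sqrt{2(1+\tau^2)\log(2k)}+\tau\Big(\sqrt{2\log(2L)}+\sqrt{2\log\tfrac{12}{\eta}}\Big)+\sqrt{2(1+\tau^2)\log\tfrac{3}{\eta}}.$$ (Only $\eta<1$ is of interest: for $\eta\ge 1$ the conclusion is trivial.) Suppose that $L$ satisfies $$A_1(L,\eta)\ \ge\ 2\,B_1(L,\eta,\tau)\qquad\text{and}\qquad \frac{A_1(L,\eta)}{C_1(\eta,d)}\ \ge\ \tau .$$ Let $v_1,\dots,v_L$ be independent random vectors, each uniformly distributed on the unit sphere $\{v\in\mathbb{R}^d:\|v\|=1\}$. Then, with probability at least $1-\eta$, there is an index $\ell\in\{1,\dots,L\}$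 such that $$|v_\ell^Tu_1|\ge 2\,|v_\ell^Tu_i|\ \text{ for all } i\ne 1\qquad\text{and}\qquad |v_\ell^Tu_1|\ge\tau .$$ (These two properties are the conditions for $v_\ell$ to be a good initialization of the tensor power method for the component $u_1$.) -/

import Mathlib

open MeasureTheory ProbabilityTheory

noncomputable section

/-- The unit sphere of `ℝ^d` with its Euclidean norm. -/
abbrev UnitSphere (d : ℕ) : Type :=
  Metric.sphere (0 : EuclideanSpace ℝ (Fin d)) 1

/-- The uniform distribution on the unit sphere of `ℝ^d` (for `d ≥ 1`): the surface measure
induced by Lebesgue measure, divided by its total mass. -/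
def uniformSphere (d : ℕ) : Measure (UnitSphere d) :=
  ((volume : Measure (EuclideanSpace ℝ (Fin d))).toSphere Set.univ)⁻¹ •
    (volume : Measure (EuclideanSpace ℝ (Fin d))).toSphere

/-- `A₁(L, η) = 0.5 √(log L) - √(2 log (12/η))`. -/
def initA (L : ℕ) (η : ℝ) : ℝ :=
  0.5 * √(Real.log L) - √(2 * Real.log (12 / η))

/-- `B₁(L, η, τ) = √(2(1+τ²) log (2k)) + τ (√(2 log (2L)) + √(2 log (12/η)))
+ √(2(1+τ²) log (3/η))`. -/
def initB (k L : ℕ) (η τ : ℝ) : ℝ :=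
  √(2 * (1 + τ ^ 2) * Real.log (2 * k))
    + τ * (√(2 * Real.log (2 * L)) + √(2 * Real.log (12 / η)))
    + √(2 * (1 + τ ^ 2) * Real.log (3 / η))

/-- `C₁(η, d) = √(3 log (3/η) d + 2 log (3/η))`. -/
def initC (η : ℝ) (d : ℕ) : ℝ :=
  √(3 * Real.log (3 / η) * d + 2 * Real.log (3 / η))

end

/-!
The law of the direction of a standard Gaussian vector `g` in `ℝ^d` is the uniform distribution on
the sphere (`stdGaussian_apply_cone`, by polar coordinates), and being a good initialisation is a
property of the direction, so one sample succeeds with the probability `p` that `g` lies in the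
cone `goodCone u 0 τ`. The `L` samples being independent, all of them fail with probability
`(1 - p) ^ L ≤ exp (-p L)` (`one_sub_exp_le_measureReal_exists_mem`), and it suffices that `p` is
much larger than `log (1/η) / L`.

To bound `p` from below, split `g` into its component `X` along `u 0` and its orthogonal part `Y`,
which are independent. The condition `A₁ ≥ 2 B₁` forces `τ² ≤ 1/32` (`sq_incoherence_le`), and `g`
is good as soon as `|X| ≥ A₁`, all `|⟪u i, Y⟫|` are at most `√(2 log (2k) + 2 log (3/η))`, and
`‖Y‖² ≤ (31/32) C₁²` (`mem_goodCone`). The conditions on `Y` hold with probability at least `30/93`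
by a union bound and Markov's inequality. Since `A₁ + 1 ≤ √(log L) / 2`, the first condition has
probability at least `L ^ (-1/8) / √(2π)`. Hence `p ≥ L ^ (-1/8) / 8`
(`exp_le_stdGaussian_goodCone`), while `A₁ ≥ 0` gives `12/η ≤ L ^ (1/8)`, and `exp (-p L) ≤ η`
follows (`exp_neg_mul_le`).

Working with independent trials replaces the selection of the sample with the largest component
along `u 0`, and with it any concentration inequality for a maximum of Gaussian variables.
-/

/-! ### Standard Gaussian vectors -/

section StandardGaussian

variable {E : Type*} [NormedAddCommGroup E] [InnerProductSpace ℝ E] [FiniteDimensional ℝ E]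
  [MeasurableSpace E] [BorelSpace E]

/-- The density of the standard Gaussian measure; both sides have the same characteristic
function. -/
theorem stdGaussian_eq_withDensity :
    stdGaussian E = (volume : Measure E).withDensity fun x =>
      ENNReal.ofReal ((2 * Real.pi) ^ (-(Module.finrank ℝ E / 2 : ℝ)) *
        Real.exp (-(1 / 2) * ‖x‖ ^ 2)) := by
  have hint : Integrable (fun x : E => (2 * Real.pi) ^ (-(Module.finrank ℝ E / 2 : ℝ)) *
      Real.exp (-(1 / 2) * ‖x‖ ^ 2)) := by
    refine Integrable.const_mul ?_ _
    have h := GaussianFourier.integrable_cexp_neg_mul_sq_norm_add (V := E) (b := (1 / 2 : ℂ))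
      (by norm_num) 0 0
    have h2 := h.norm
    simpa [Complex.norm_exp, ← Complex.ofReal_pow] using h2
  have hpos : ∀ x : E, 0 ≤ (2 * Real.pi) ^ (-(Module.finrank ℝ E / 2 : ℝ)) *
      Real.exp (-(1 / 2) * ‖x‖ ^ 2) := fun x => by positivity
  have : IsFiniteMeasure ((volume : Measure E).withDensity fun x =>
      ENNReal.ofReal ((2 * Real.pi) ^ (-(Module.finrank ℝ E / 2 : ℝ)) *
        Real.exp (-(1 / 2) * ‖x‖ ^ 2))) := isFiniteMeasure_withDensity_ofReal hint.2
  refine Measure.ext_of_charFun ?_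
  ext t
  rw [charFun_stdGaussian, charFun_apply, integral_withDensity_eq_integral_toReal_smul₀
    hint.1.aemeasurable.ennreal_ofReal (by simp)]
  have key := GaussianFourier.integral_cexp_neg_mul_sq_norm_add (V := E) (b := (1 / 2 : ℂ))
      (by norm_num) Complex.I t
  have hc : (((2 * Real.pi) ^ (-(Module.finrank ℝ E / 2 : ℝ)) : ℝ) : ℂ) *
      ((Real.pi : ℂ) / (1 / 2)) ^ (Module.finrank ℝ E / 2 : ℂ) = 1 := by
    have h2 : ((Real.pi : ℂ) / (1 / 2)) = ((2 * Real.pi : ℝ) : ℂ) := by push_cast; ring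
    have h3 : (Module.finrank ℝ E / 2 : ℂ) = ((Module.finrank ℝ E / 2 : ℝ) : ℂ) := by
      push_cast; ring
    rw [h2, h3, ← Complex.ofReal_cpow (by positivity), ← Complex.ofReal_mul,
      ← Real.rpow_add (by positivity)]
    simp
  calc Complex.exp (-‖t‖ ^ 2 / 2)
      = (((2 * Real.pi) ^ (-(Module.finrank ℝ E / 2 : ℝ)) : ℝ) : ℂ) *
        ∫ v : E, Complex.exp (-(1 / 2) * ‖v‖ ^ 2 + Complex.I * inner ℝ t v) := by
        rw [key, ← mul_assoc, hc, one_mul]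
        congr 1
        rw [Complex.I_sq]; ring
    _ = _ := by
        rw [← integral_const_mul]
        refine integral_congr_ae (Filter.Eventually.of_forall fun x => ?_)
        simp only [ENNReal.toReal_ofReal (hpos x), Complex.real_smul]
        rw [Complex.exp_add, real_inner_comm x t]
        push_cast
        ring_nf

/-- Polar coordinates for a product of an angular and a radial function. -/
theorem lintegral_polar (μ : Measure E) [μ.IsAddHaarMeasure]
    {g : Metric.sphere (0 : E) 1 → ENNReal} {f : Set.Ioi (0 : ℝ) → ENNReal}
    (hg : Measurable g) (hf : Measurable f) :
    ∫⁻ x : ({0}ᶜ : Set E), g (homeomorphUnitSphereProd E x).1 *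
        f (homeomorphUnitSphereProd E x).2 ∂(μ.comap (↑)) =
      (∫⁻ y, g y ∂μ.toSphere) * ∫⁻ r, f r ∂(Measure.volumeIoiPow (Module.finrank ℝ E - 1)) := by
  rw [← lintegral_prod_mul hg.aemeasurable hf.aemeasurable,
    ← μ.measurePreserving_homeomorphUnitSphereProd.lintegral_comp (by fun_prop)]

/-- The direction of a standard Gaussian vector is uniform on the sphere: a cone has the Gaussian
measure equal to the normalised surface measure of its trace on the sphere. -/
theorem stdGaussian_apply_cone [Nontrivial E] {T : Set E} (hT : MeasurableSet T)
    (hcone : ∀ x : E, ∀ r : ℝ, 0 < r → (r • x ∈ T ↔ x ∈ T)) :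
    stdGaussian E T = ((volume : Measure E).toSphere Set.univ)⁻¹ *
      (volume : Measure E).toSphere ((↑) ⁻¹' T) := by
  set f : ℝ → ENNReal := fun r => ENNReal.ofReal
    ((2 * Real.pi) ^ (-(Module.finrank ℝ E / 2 : ℝ)) * Real.exp (-(1 / 2) * r ^ 2)) with hf
  have hfm : Measurable f := by rw [hf]; fun_prop
  set I := ∫⁻ r, f r.1 ∂(Measure.volumeIoiPow (Module.finrank ℝ E - 1)) with hI
  have key : ∀ S : Set E, MeasurableSet S → (∀ x : E, ∀ r : ℝ, 0 < r → (r • x ∈ S ↔ x ∈ S)) →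
      stdGaussian E S = (volume : Measure E).toSphere ((↑) ⁻¹' S) * I := by
    intro S hS hSc
    set G : Set (Metric.sphere (0 : E) 1) := (↑) ⁻¹' S with hGdef
    have hG : MeasurableSet G := measurable_subtype_coe hS
    calc stdGaussian E S = ∫⁻ x, S.indicator (fun x => f ‖x‖) x := by
          rw [stdGaussian_eq_withDensity, withDensity_apply _ hS, lintegral_indicator hS]
      _ = ∫⁻ x in ({0}ᶜ : Set E), S.indicator (fun x => f ‖x‖) x := by
          rw [restrict_compl_singleton]
      _ = ∫⁻ x : ({0}ᶜ : Set E), S.indicator (fun x => f ‖x‖) x.1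
            ∂((volume : Measure E).comap (↑)) :=
          (lintegral_subtype_comap (measurableSet_singleton 0).compl _).symm
      _ = ∫⁻ x : ({0}ᶜ : Set E), G.indicator (fun _ => 1) (homeomorphUnitSphereProd E x).1 *
            f (homeomorphUnitSphereProd E x).2.1 ∂((volume : Measure E).comap (↑)) := by
          refine lintegral_congr fun x => ?_
          have hx : x.1 ≠ 0 := x.2
          have h1 : (homeomorphUnitSphereProd E x).1 ∈ G ↔ x.1 ∈ S := by
            rw [hGdef, Set.mem_preimage, homeomorphUnitSphereProd_apply_fst_coe]
            exact hSc _ _ (by positivity)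
          by_cases hxS : x.1 ∈ S
          · simp only [Set.indicator_of_mem hxS, Set.indicator_of_mem (h1.2 hxS), one_mul,
              homeomorphUnitSphereProd_apply_snd_coe]
          · simp only [Set.indicator_of_notMem hxS, Set.indicator_of_notMem (mt h1.1 hxS), zero_mul]
      _ = (volume : Measure E).toSphere G * I := by
          rw [lintegral_polar (volume : Measure E) (g := G.indicator fun _ => 1)
            (f := fun r => f r.1) (measurable_const.indicator hG)
            (hfm.comp measurable_subtype_coe), lintegral_indicator_const hG, one_mul]
  -- The radial factor is the inverse of the total surface area, by the case of the whole space.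
  have huniv := key Set.univ MeasurableSet.univ (by simp)
  rw [measure_univ, Set.preimage_univ] at huniv
  rw [key T hT hcone, ENNReal.eq_inv_of_mul_eq_one_left ((mul_comm _ _).trans huniv.symm),
    mul_comm]

theorem map_inner_stdGaussian (w : E) :
    (stdGaussian E).map (fun x => inner ℝ w x) = gaussianReal 0 (‖w‖ ^ 2).toNNReal := by
  have h := IsGaussian.map_eq_gaussianReal (μ := stdGaussian E) (innerSL ℝ w)
  rw [variance_dual_stdGaussian, integral_strongDual_stdGaussian, innerSL_apply_norm] at h
  exact h

/-- The component of a standard Gaussian vector along a unit vector is independent of its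
orthogonal part, since the two are jointly Gaussian and uncorrelated. -/
theorem indepFun_inner_sub_smul_stdGaussian {u : E} (hu : ‖u‖ = 1) :
    IndepFun (fun x : E => inner ℝ u x) (fun x => x - inner ℝ u x • u) (stdGaussian E) := by
  refine HasGaussianLaw.indepFun_of_covariance_inner (E := ℝ) ?_ fun a y => ?_
  · have h : HasGaussianLaw (id : E → E) (stdGaussian E) := 
      ⟨by rw [Measure.map_id]; infer_instance⟩
    exact h.map ((innerSL ℝ u).prod
      (ContinuousLinearMap.id ℝ E - (innerSL ℝ u).smulRight u))
  · have h1 : (fun x : E => inner ℝ a (inner ℝ u x)) = fun x => inner ℝ (a • u) x := by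
      ext x; simp [real_inner_smul_left, mul_comm]
    have h2 : (fun x : E => inner ℝ y (x - inner ℝ u x • u)) =
        fun x => inner ℝ (y - inner ℝ y u • u) x := by
      ext x; simp [inner_sub_left, inner_sub_right, real_inner_smul_left, real_inner_smul_right,
        mul_comm]
    rw [h1, h2, ← covarianceBilin_apply_eq_cov IsGaussian.memLp_two_id, covarianceBilin_stdGaussian]
    rw [innerSL_apply_apply, inner_sub_right, real_inner_smul_left, real_inner_smul_left,
      real_inner_smul_right, real_inner_self_eq_norm_sq, hu, real_inner_comm y u]
    ring

theorem lintegral_norm_sq_stdGaussian :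
    ∫⁻ x, ENNReal.ofReal (‖x‖ ^ 2) ∂(stdGaussian E) = Module.finrank ℝ E := by
  set b := stdOrthonormalBasis ℝ E
  have h1 : ∀ i, ∫⁻ x, ENNReal.ofReal (inner ℝ (b i) x ^ 2) ∂(stdGaussian E) = 1 := by
    intro i
    have h := lintegral_map (μ := stdGaussian E) (f := fun r : ℝ => ENNReal.ofReal (r ^ 2))
      (g := fun x => inner ℝ (b i) x) (by fun_prop) (by fun_prop)
    rw [← h, map_inner_stdGaussian, b.norm_eq_one, ← ofReal_integral_eq_lintegral_ofReal]
    · have hv := variance_fun_id_gaussianReal (μ := 0) (v := ((1 : ℝ) ^ 2).toNNReal)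
      rw [variance_eq_integral (by fun_prop), integral_id_gaussianReal] at hv
      simpa using hv
    · exact (memLp_id_gaussianReal 2).integrable_sq
    · exact Filter.Eventually.of_forall fun x => sq_nonneg _
  calc ∫⁻ x, ENNReal.ofReal (‖x‖ ^ 2) ∂(stdGaussian E)
      = ∫⁻ x, ∑ i, ENNReal.ofReal (inner ℝ (b i) x ^ 2) ∂(stdGaussian E) := by
        refine lintegral_congr fun x => ?_
        rw [← ENNReal.ofReal_sum_of_nonneg fun i _ => sq_nonneg _, ← b.sum_sq_norm_inner_right x]
        simp
    _ = _ := by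
        rw [lintegral_finsetSum _ fun i _ => by fun_prop]
        simp [h1]

theorem stdGaussian_le_norm_sq_le {R : ℝ} (hR : 0 < R) :
    (stdGaussian E).real {x | R ≤ ‖x‖ ^ 2} ≤ Module.finrank ℝ E / R := by
  have h := meas_ge_le_lintegral_div (μ := stdGaussian E)
    (f := fun x => ENNReal.ofReal (‖x‖ ^ 2)) (by fun_prop) (ε := ENNReal.ofReal R)
    (by simpa using hR) (by simp)
  rw [lintegral_norm_sq_stdGaussian] at h
  have h2 := ENNReal.toReal_mono (by simp [ENNReal.div_eq_top, hR]) h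
  rw [ENNReal.toReal_div, ENNReal.toReal_ofReal hR.le, ENNReal.toReal_natCast] at h2
  have h3 : {x : E | R ≤ ‖x‖ ^ 2} = {x : E | ENNReal.ofReal R ≤ ENNReal.ofReal (‖x‖ ^ 2)} := by
    ext x
    exact (ENNReal.ofReal_le_ofReal_iff (by positivity)).symm
  rwa [h3]

end StandardGaussian

/-! ### Tails of the real Gaussian distribution -/

section GaussianTails

theorem gaussianReal_le_abs_le (v : NNReal) (hv : v ≤ 1) {t : ℝ} (ht : 0 ≤ t) :
    (gaussianReal 0 v).real {x | t ≤ |x|} ≤ 2 * Real.exp (-t ^ 2 / 2) := by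
  have hv' : (v : ℝ) ≤ 1 := by exact_mod_cast hv
  have h1 := measure_ge_le_exp_mul_mgf (μ := gaussianReal 0 v) (X := fun x => x) t ht
    (integrable_exp_mul_gaussianReal t)
  have h2 := measure_le_le_exp_mul_mgf (μ := gaussianReal 0 v) (X := fun x => x) (t := -t) (-t)
    (by linarith) (integrable_exp_mul_gaussianReal (-t))
  rw [mgf_fun_id_gaussianReal] at h1 h2
  have hsub : {x : ℝ | t ≤ |x|} ⊆ {x | t ≤ x} ∪ {x | x ≤ -t} := by
    intro x hx
    rcases le_abs.1 (show t ≤ |x| from hx) with h | h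
    · exact Or.inl h
    · exact Or.inr (show x ≤ -t by linarith)
  have hb : Real.exp (-t * t) * Real.exp (0 * t + v * t ^ 2 / 2) ≤ Real.exp (-t ^ 2 / 2) := by
    rw [← Real.exp_add, Real.exp_le_exp]
    nlinarith [sq_nonneg t]
  have hb2 : Real.exp (-(-t) * -t) * Real.exp (0 * -t + v * (-t) ^ 2 / 2) ≤
      Real.exp (-t ^ 2 / 2) := by
    rw [← Real.exp_add, Real.exp_le_exp]
    nlinarith [sq_nonneg t]
  have := measureReal_mono (μ := gaussianReal 0 v) hsub
  have := measureReal_union_le (μ := gaussianReal 0 v) {x : ℝ | t ≤ x} {x | x ≤ -t}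
  linarith

/-- Lower bound on the Gaussian tail: the density on `[a, a + 1]` is at least its value at
`a + 1`. -/
theorem le_gaussianReal_le_abs {a : ℝ} (ha : 0 ≤ a) :
    Real.exp (-(a + 1) ^ 2 / 2) / √(2 * Real.pi) ≤ (gaussianReal 0 1).real {x | a ≤ |x|} := by
  have h1 : (gaussianReal 0 1).real (Set.Icc a (a + 1)) ≤ (gaussianReal 0 1).real {x | a ≤ |x|} :=
    measureReal_mono fun x hx => hx.1.trans (le_abs_self x)
  refine le_trans ?_ h1
  have h2 : (gaussianReal 0 1).real (Set.Icc a (a + 1)) =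
      ∫ x in Set.Icc a (a + 1), gaussianPDFReal 0 1 x := by
    rw [measureReal_def, gaussianReal_apply_eq_integral _ one_ne_zero, ENNReal.toReal_ofReal]
    exact integral_nonneg fun x => gaussianPDFReal_nonneg _ _ _
  have h3 : ∫ _ in Set.Icc a (a + 1), Real.exp (-(a + 1) ^ 2 / 2) / √(2 * Real.pi) =
      Real.exp (-(a + 1) ^ 2 / 2) / √(2 * Real.pi) := by
    simp
  rw [h2, ← h3]
  refine setIntegral_mono_on (by simp) (integrable_gaussianPDFReal _ _).integrableOn
    measurableSet_Icc fun x hx => ?_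
  rw [gaussianPDFReal, div_eq_inv_mul]
  simp only [NNReal.coe_one, mul_one, sub_zero]
  gcongr
  · linarith [hx.1]
  · exact hx.2

end GaussianTails

/-! ### Success probability of one sample -/

section OneSample

variable {E : Type*} [NormedAddCommGroup E] [InnerProductSpace ℝ E]

/-- The directions `x` that are good initialisations for the component `u i₀`, as a cone: the
conditions on the unit vector `x / ‖x‖` are multiplied by `‖x‖`. -/
def goodCone {ι : Type*} (u : ι → E) (i₀ : ι) (τ : ℝ) : Set E :=
  {x | (∀ i, i ≠ i₀ → 2 * |inner ℝ x (u i)| ≤ |inner ℝ x (u i₀)|) ∧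
    τ * ‖x‖ ≤ |inner ℝ x (u i₀)|}

theorem smul_mem_goodCone_iff {ι : Type*} (u : ι → E) (i₀ : ι) (τ : ℝ) (x : E) (r : ℝ)
    (hr : 0 < r) : r • x ∈ goodCone u i₀ τ ↔ x ∈ goodCone u i₀ τ := by
  have h1 : ∀ a b : ℝ, 2 * (r * a) ≤ r * b ↔ 2 * a ≤ b := fun a b => by
    rw [mul_left_comm, mul_le_mul_iff_right₀ hr]
  have h2 : ∀ a b : ℝ, τ * (r * a) ≤ r * b ↔ τ * a ≤ b := fun a b => by
    rw [mul_left_comm, mul_le_mul_iff_right₀ hr]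
  simp only [goodCone, Set.mem_ofPred_eq, real_inner_smul_left, abs_mul, norm_smul,
    Real.norm_eq_abs, abs_of_pos hr, h1, h2]

theorem measurableSet_goodCone [MeasurableSpace E] [BorelSpace E] {ι : Type*} [Finite ι]
    (u : ι → E) (i₀ : ι) (τ : ℝ) : MeasurableSet (goodCone u i₀ τ) := by
  have : IsClosed (goodCone u i₀ τ) := by
    simp only [goodCone, Set.ofPred_and, Set.ofPred_forall]
    refine IsClosed.inter (isClosed_iInter fun i => isClosed_iInter fun _ => ?_) ?_
    · exact isClosed_le (by fun_prop) (by fun_prop)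
    · exact isClosed_le (by fun_prop) (by fun_prop)
  exact this.measurableSet

/-- A vector with a large component along `u i₀` and a controlled orthogonal part `y` is good:
`|⟪u i, x⟫| ≤ τ |⟪u i₀, x⟫| + |⟪u i, y⟫|` and `‖x‖² = ⟪u i₀, x⟫² + ‖y‖²`. -/
theorem mem_goodCone {ι : Type*} {u : ι → E} {i₀ : ι} {τ a z R : ℝ} (hu : ‖u i₀‖ = 1)
    (hinc : ∀ i, i ≠ i₀ → |inner ℝ (u i) (u i₀)| ≤ τ) (ha : 0 ≤ a) (hτ0 : 0 ≤ τ) (hτ : 2 * τ ≤ 1)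
    (hz : 2 * z ≤ (1 - 2 * τ) * a) (hR : τ ^ 2 * R ≤ (1 - τ ^ 2) * a ^ 2) {x : E}
    (hx : a ≤ |inner ℝ (u i₀) x|)
    (hxz : ∀ i, |inner ℝ (u i) (x - inner ℝ (u i₀) x • u i₀)| ≤ z)
    (hxR : ‖x - inner ℝ (u i₀) x • u i₀‖ ^ 2 ≤ R) :
    x ∈ goodCone u i₀ τ := by
  refine ⟨fun i hi => ?_, ?_⟩
  · have h1 := hxz i
    rw [inner_sub_right, real_inner_smul_right] at h1
    have h2 : |inner ℝ (u i₀) x * inner ℝ (u i) (u i₀)| ≤ |inner ℝ (u i₀) x| * τ := by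
      rw [abs_mul]
      exact mul_le_mul_of_nonneg_left (hinc i hi) (abs_nonneg _)
    have h3 := abs_add_le (inner ℝ (u i) x - inner ℝ (u i₀) x * inner ℝ (u i) (u i₀))
      (inner ℝ (u i₀) x * inner ℝ (u i) (u i₀))
    rw [sub_add_cancel] at h3
    rw [real_inner_comm, real_inner_comm (u i₀) x]
    nlinarith
  · have h1 : ‖x - inner ℝ (u i₀) x • u i₀‖ ^ 2 = ‖x‖ ^ 2 - inner ℝ (u i₀) x ^ 2 := by
      rw [norm_sub_sq_real, norm_smul, hu, real_inner_smul_right, real_inner_comm (u i₀) x,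
        mul_one, Real.norm_eq_abs, sq_abs]
      ring
    have h2 : a ^ 2 ≤ inner ℝ (u i₀) x ^ 2 := by
      rw [← sq_abs (inner ℝ (u i₀) x)]
      gcongr
    rw [real_inner_comm (u i₀) x]
    refine abs_le_of_sq_le_sq' ?_ (abs_nonneg _) |>.2
    rw [sq_abs, mul_pow]
    rw [h1] at hxR
    have h3 : 0 ≤ 1 - τ ^ 2 := by nlinarith
    linarith [mul_le_mul_of_nonneg_left hxR (sq_nonneg τ), mul_le_mul_of_nonneg_left h2 h3]

variable [FiniteDimensional ℝ E] [MeasurableSpace E] [BorelSpace E]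

/-- The first factor bounds the probability that the component along `u i₀` exceeds `a`, the second
one the probability that the orthogonal part is controlled (union bound over the components and
Markov's inequality for the squared norm); the two events are independent. -/
theorem stdGaussian_goodCone_ge {ι : Type*} [Fintype ι] {u : ι → E} {i₀ : ι} {τ a z R : ℝ}
    (hu : ∀ i, ‖u i‖ = 1) (hinc : ∀ i, i ≠ i₀ → |inner ℝ (u i) (u i₀)| ≤ τ)
    (ha : 0 ≤ a) (hτ0 : 0 ≤ τ) (hτ : 2 * τ ≤ 1) (hz0 : 0 ≤ z) (hR0 : 0 < R)
    (hz : 2 * z ≤ (1 - 2 * τ) * a) (hR : τ ^ 2 * R ≤ (1 - τ ^ 2) * a ^ 2) :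
    (Real.exp (-(a + 1) ^ 2 / 2) / √(2 * Real.pi)) *
      (1 - (Fintype.card ι * (2 * Real.exp (-z ^ 2 / 2)) + Module.finrank ℝ E / R)) ≤
      (stdGaussian E).real (goodCone u i₀ τ) := by
  set γ := stdGaussian E
  let X : E → ℝ := fun x => inner ℝ (u i₀) x
  let Y : E → E := fun x => x - inner ℝ (u i₀) x • u i₀
  have hY : Measurable Y := by fun_prop
  set S : Set ℝ := {t | a ≤ |t|}
  have hS : MeasurableSet S := measurableSet_le (by fun_prop) (by fun_prop)
  set W : Set E := {y | (∀ i, |inner ℝ (u i) y| < z) ∧ ‖y‖ ^ 2 < R}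
  have hW : MeasurableSet W := by
    simp only [W, Set.ofPred_and, Set.ofPred_forall]
    exact (MeasurableSet.iInter fun i => measurableSet_lt (by fun_prop) (by fun_prop)).inter
      (measurableSet_lt (by fun_prop) (by fun_prop))
  have hsub : X ⁻¹' S ∩ Y ⁻¹' W ⊆ goodCone u i₀ τ := fun x hx =>
    mem_goodCone (hu i₀) hinc ha hτ0 hτ hz hR hx.1 (fun i => (hx.2.1 i).le) hx.2.2.le
  have hind : γ.real (X ⁻¹' S ∩ Y ⁻¹' W) = γ.real (X ⁻¹' S) * γ.real (Y ⁻¹' W) := by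
    rw [measureReal_def, (indepFun_inner_sub_smul_stdGaussian (hu i₀)).measure_inter_preimage_eq_mul
      S W hS hW, ENNReal.toReal_mul]
    rfl
  have hproj : ∀ y : E, ‖y‖ = 1 → ∀ x : E, ‖x - inner ℝ y x • y‖ ^ 2 ≤ ‖x‖ ^ 2 := by
    intro y hy x
    rw [norm_sub_sq_real, norm_smul, hy, real_inner_smul_right, real_inner_comm y x,
      mul_one, Real.norm_eq_abs, sq_abs]
    nlinarith [sq_nonneg (inner ℝ y x)]
  have hSp : Real.exp (-(a + 1) ^ 2 / 2) / √(2 * Real.pi) ≤ γ.real (X ⁻¹' S) := by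
    have h := le_gaussianReal_le_abs ha
    have h2 := map_inner_stdGaussian (u i₀)
    simp only [hu, one_pow, Real.toNNReal_one] at h2
    rwa [← h2, map_measureReal_apply (by fun_prop) hS] at h
  have hWc : γ.real (Y ⁻¹' Wᶜ) ≤
      Fintype.card ι * (2 * Real.exp (-z ^ 2 / 2)) + Module.finrank ℝ E / R := by
    have hcov : Y ⁻¹' Wᶜ ⊆ (⋃ i, {x | z ≤ |inner ℝ (u i - inner ℝ (u i₀) (u i) • u i₀) x|}) ∪
        {x | R ≤ ‖x‖ ^ 2} := by
      intro x hx
      by_contra hcon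
      simp only [Set.mem_union, Set.mem_iUnion, Set.mem_ofPred_eq, not_or, not_exists, not_le]
        at hcon
      refine hx ⟨fun i => ?_, (hproj _ (hu i₀) x).trans_lt hcon.2⟩
      have h := hcon.1 i
      rw [inner_sub_left, real_inner_smul_left] at h
      rw [inner_sub_right, real_inner_smul_right, real_inner_comm (u i₀) (u i), mul_comm]
      exact h
    refine (measureReal_mono hcov).trans ((measureReal_union_le _ _).trans ?_)
    refine add_le_add ((measureReal_iUnion_fintype_le _).trans ?_) (stdGaussian_le_norm_sq_le hR0)
    refine (Finset.sum_le_card_nsmul _ _ (2 * Real.exp (-z ^ 2 / 2)) fun i _ => ?_).trans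
      (by simp)
    set w := u i - inner ℝ (u i₀) (u i) • u i₀
    have hw : ‖w‖ ^ 2 ≤ 1 := by
      have := hproj _ (hu i₀) (u i)
      rwa [hu i, one_pow] at this
    have h := gaussianReal_le_abs_le (‖w‖ ^ 2).toNNReal (by simpa using hw) hz0
    rwa [← map_inner_stdGaussian w, map_measureReal_apply (by fun_prop)
      (measurableSet_le (by fun_prop) (by fun_prop))] at h
  have hWp : 1 - (Fintype.card ι * (2 * Real.exp (-z ^ 2 / 2)) + Module.finrank ℝ E / R) ≤
      γ.real (Y ⁻¹' W) := by
    have := probReal_compl_eq_one_sub (μ := γ) (hY hW)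
    rw [← Set.preimage_compl] at this
    linarith
  calc _ ≤ (Real.exp (-(a + 1) ^ 2 / 2) / √(2 * Real.pi)) * γ.real (Y ⁻¹' W) :=
        mul_le_mul_of_nonneg_left hWp (by positivity)
    _ ≤ γ.real (X ⁻¹' S) * γ.real (Y ⁻¹' W) :=
        mul_le_mul_of_nonneg_right hSp measureReal_nonneg
    _ ≤ _ := hind ▸ measureReal_mono hsub

end OneSample

/-! ### Independent uniform samples -/

theorem uniformSphere_apply_cone {d : ℕ} (hd : d ≠ 0) {T : Set (EuclideanSpace ℝ (Fin d))}
    (hT : MeasurableSet T)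
    (hcone : ∀ x : EuclideanSpace ℝ (Fin d), ∀ r : ℝ, 0 < r → (r • x ∈ T ↔ x ∈ T)) :
    uniformSphere d ((↑) ⁻¹' T) = stdGaussian (EuclideanSpace ℝ (Fin d)) T := by
  have : NeZero d := ⟨hd⟩
  rw [stdGaussian_apply_cone hT hcone, uniformSphere, Measure.smul_apply, smul_eq_mul]

/-- Independent trials: an event of probability `p` in each of `L` trials fails to occur
with probability `(1 - p) ^ L ≤ exp (-(p * L))`. -/
theorem one_sub_exp_le_measureReal_exists_mem {Ω S : Type*} [MeasurableSpace Ω]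
    [MeasurableSpace S] {P : Measure Ω} [IsProbabilityMeasure P] {L : ℕ} {v : Fin L → Ω → S}
    {μ : Measure S} (hlaw : ∀ l, HasLaw (v l) μ P) (hindep : iIndepFun v P) {G : Set S}
    (hG : MeasurableSet G) :
    1 - Real.exp (-(μ.real G * L)) ≤ P.real {ω | ∃ l, v l ω ∈ G} := by
  have hfail : ∀ l, P.real (v l ⁻¹' Gᶜ) = 1 - μ.real G := by
    intro l
    have hμ : IsProbabilityMeasure μ := by
      rw [← (hlaw l).map_eq]
      exact Measure.isProbabilityMeasure_map (hlaw l).aemeasurable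
    rw [← probReal_compl_eq_one_sub hG, ← (hlaw l).map_eq,
      map_measureReal_apply_of_aemeasurable (hlaw l).aemeasurable hG.compl]
  have hcompl : {ω | ∃ l, v l ω ∈ G}ᶜ = ⋂ l ∈ Finset.univ, v l ⁻¹' Gᶜ := by
    ext ω; simp
  have hall : P.real {ω | ∃ l, v l ω ∈ G}ᶜ ≤ Real.exp (-(μ.real G * L)) := by
    rw [hcompl, measureReal_def,
      hindep.measure_inter_preimage_eq_mul Finset.univ (sets := fun _ => Gᶜ) fun _ _ => hG.compl,
      ENNReal.toReal_prod]
    calc ∏ l, (P (v l ⁻¹' Gᶜ)).toReal ≤ ∏ _l : Fin L, Real.exp (-μ.real G) := by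
          refine Finset.prod_le_prod (fun _ _ => ENNReal.toReal_nonneg) fun l _ => ?_
          have h1 := hfail l
          rw [measureReal_def] at h1
          rw [h1]
          linarith [Real.add_one_le_exp (-μ.real G)]
      _ = Real.exp (-(μ.real G * L)) := by
          rw [Finset.prod_const, Finset.card_univ, Fintype.card_fin, ← Real.exp_nat_mul]
          ring_nf
  have h := measureReal_union_le (μ := P) {ω | ∃ l, v l ω ∈ G} {ω | ∃ l, v l ω ∈ G}ᶜ
  rw [Set.union_compl_self, probReal_univ] at h
  linarith

/-! ### Consequences of the conditions on the number of samples -/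

section InitializationBounds

theorem one_le_log_three_div {η : ℝ} (hη : 0 < η) (hη1 : η < 1) : 1 ≤ Real.log (3 / η) := by
  rw [Real.le_log_iff_exp_le (by positivity), le_div_iff₀ hη]
  nlinarith [Real.exp_one_lt_d9, Real.exp_pos 1]

theorem one_le_log_twelve_div {η : ℝ} (hη : 0 < η) (hη1 : η < 1) : 1 ≤ Real.log (12 / η) :=
  (one_le_log_three_div hη hη1).trans (by gcongr; norm_num)

variable {d k L : ℕ} {η τ : ℝ}

theorem initB_nonneg (hτ : 0 ≤ τ) : 0 ≤ initB k L η τ := by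
  unfold initB; positivity

theorem initA_nonneg (hτ : 0 ≤ τ) (h : 2 * initB k L η τ ≤ initA L η) : 0 ≤ initA L η :=
  (mul_nonneg zero_le_two (initB_nonneg hτ)).trans h

theorem initA_le_half_sqrt_log : initA L η ≤ 0.5 * √(Real.log L) :=
  sub_le_self _ (Real.sqrt_nonneg _)

theorem initA_add_one_le (hη : 0 < η) (hη1 : η < 1) : initA L η + 1 ≤ 0.5 * √(Real.log L) := by
  have : 1 ≤ √(2 * Real.log (12 / η)) := by
    rw [Real.one_le_sqrt]
    linarith [one_le_log_twelve_div hη hη1]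
  unfold initA
  linarith

theorem eight_mul_log_twelve_div_le (hL : 1 ≤ L) (hη : 0 < η) (hη1 : η < 1)
    (hA : 0 ≤ initA L η) : 8 * Real.log (12 / η) ≤ Real.log L := by
  have hℓ : 0 ≤ Real.log L := Real.log_nonneg (by exact_mod_cast hL)
  have hh := one_le_log_twelve_div hη hη1
  have h1 : √(2 * Real.log (12 / η)) ≤ 0.5 * √(Real.log L) := by
    unfold initA at hA; linarith
  have h2 := mul_self_le_mul_self (Real.sqrt_nonneg _) h1
  rw [Real.mul_self_sqrt (by linarith)] at h2
  nlinarith [Real.mul_self_sqrt hℓ]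

theorem sqrt_log_le_sqrt_two_mul_log (hL : 1 ≤ L) :
    √2 * √(Real.log L) ≤ √(2 * Real.log (2 * L)) := by
  have hL' : (1 : ℝ) ≤ L := by exact_mod_cast hL
  rw [← Real.sqrt_mul zero_le_two]
  gcongr
  linarith

/-- The condition `A₁ ≥ 2 B₁` alone makes the incoherence small: the term `τ √(2 log (2L))` of `B₁`
dominates `τ √2 √(log L)`, while `A₁` is at most half of `√(log L)`. -/
theorem sq_incoherence_le (hL : 1 ≤ L) (hη : 0 < η) (hη1 : η < 1) (hτ : 0 ≤ τ)
    (h : 2 * initB k L η τ ≤ initA L η) : τ ^ 2 ≤ 1 / 32 := by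
  have hℓ : 0 < √(Real.log L) := by
    rw [Real.sqrt_pos]
    linarith [eight_mul_log_twelve_div_le hL hη hη1 (initA_nonneg hτ h),
      one_le_log_twelve_div hη hη1]
  have h1 : τ * √(2 * Real.log (2 * L)) ≤ initB k L η τ := by
    have h2 : 0 ≤ √(2 * (1 + τ ^ 2) * Real.log (2 * k)) + τ * √(2 * Real.log (12 / η))
      + √(2 * (1 + τ ^ 2) * Real.log (3 / η)) := by positivity
    unfold initB
    linarith
  have h2 := mul_le_mul_of_nonneg_left (sqrt_log_le_sqrt_two_mul_log hL) hτ
  have h3 : τ * √2 ≤ 1 / 4 := by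
    refine le_of_mul_le_mul_right ?_ hℓ
    linarith [initA_le_half_sqrt_log (L := L) (η := η)]
  have h4 := mul_self_le_mul_self (by positivity) h3
  have h5 : τ * √2 * (τ * √2) = 2 * τ ^ 2 := by
    rw [mul_mul_mul_comm, Real.mul_self_sqrt zero_le_two]; ring
  linarith

/-- The level `√(2 log (2k) + 2 log (3/η))`, below which all `k` orthogonal parts stay with
probability `1 - η/3`, fits under `(1 - 2τ) A₁ / 2`: the leading terms of `B₁` bound it, and the
middle term of `B₁` pays for the loss `2τ A₁`, because `A₁ ≤ √(2 log (2L))`. -/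
theorem sqrt_union_level_le [NeZero k] (hη : 0 < η) (hη1 : η < 1) (hL : 1 ≤ L) (hτ : 0 ≤ τ)
    (h : 2 * initB k L η τ ≤ initA L η) :
    2 * √(2 * Real.log (2 * k) + 2 * Real.log (3 / η)) ≤ (1 - 2 * τ) * initA L η := by
  have hk : (1 : ℝ) ≤ k := by exact_mod_cast NeZero.one_le
  have hlk : 0 ≤ Real.log (2 * k) := Real.log_nonneg (by linarith)
  have hs := one_le_log_three_div hη hη1
  have h1 : √(2 * Real.log (2 * k) + 2 * Real.log (3 / η)) ≤
      √(2 * (1 + τ ^ 2) * Real.log (2 * k)) + √(2 * (1 + τ ^ 2) * Real.log (3 / η)) := by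
    refine Real.sqrt_le_iff.2 ⟨by positivity, ?_⟩
    rw [add_sq, Real.sq_sqrt (by positivity), Real.sq_sqrt (by positivity)]
    have h2 : 0 ≤ 2 * √(2 * (1 + τ ^ 2) * Real.log (2 * k)) *
      √(2 * (1 + τ ^ 2) * Real.log (3 / η)) := by positivity
    nlinarith [mul_nonneg (sq_nonneg τ) hlk, mul_nonneg (sq_nonneg τ) (zero_le_one.trans hs)]
  have hA : initA L η ≤ √(2 * Real.log (2 * L)) := by
    have h2 : (1 : ℝ) ≤ √2 := by rw [Real.one_le_sqrt]; norm_num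
    have h3 := Real.sqrt_nonneg (Real.log L)
    nlinarith [initA_le_half_sqrt_log (L := L) (η := η), sqrt_log_le_sqrt_two_mul_log hL]
  have h2 := mul_le_mul_of_nonneg_left hA hτ
  have h3 : 0 ≤ τ * √(2 * Real.log (12 / η)) := by positivity
  unfold initB at h
  linarith

theorem exp_union_level [NeZero k] (hη : 0 < η) (hη1 : η < 1) :
    k * (2 * Real.exp (-√(2 * Real.log (2 * k) + 2 * Real.log (3 / η)) ^ 2 / 2)) = η / 3 := by
  have hk : (1 : ℝ) ≤ k := by exact_mod_cast NeZero.one_le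
  have hlk : 0 ≤ Real.log (2 * k) := Real.log_nonneg (by linarith)
  have hs := one_le_log_three_div hη hη1
  rw [Real.sq_sqrt (by linarith), show -(2 * Real.log (2 * k) + 2 * Real.log (3 / η)) / 2 =
    -Real.log (2 * k) + -Real.log (3 / η) by ring, Real.exp_add, Real.exp_neg, Real.exp_neg,
    Real.exp_log (by positivity), Real.exp_log (by positivity)]
  field_simp

theorem initC_sq (hη : 0 < η) (hη1 : η < 1) :
    initC η d ^ 2 = 3 * Real.log (3 / η) * d + 2 * Real.log (3 / η) := by
  have hs := one_le_log_three_div hη hη1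
  rw [initC, Real.sq_sqrt (by positivity)]

theorem initC_pos (hη : 0 < η) (hη1 : η < 1) : 0 < initC η d := by
  have hs := one_le_log_three_div hη hη1
  exact Real.sqrt_pos.2 (by positivity)

/-- Only `log (3/η) ≥ 1` is used, so that Markov's inequality for `‖g‖²` gives a failure
probability below `32/93`; the factor `31/32` leaves room for `1 - τ²`. -/
theorem div_initC_sq_le (hη : 0 < η) (hη1 : η < 1) :
    (d : ℝ) / (31 / 32 * initC η d ^ 2) ≤ 32 / 93 := by
  have hs := one_le_log_three_div hη hη1
  have hC : 0 < initC η d ^ 2 := pow_pos (initC_pos hη hη1) 2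
  rw [div_le_iff₀ (by positivity), initC_sq hη hη1]
  nlinarith [Nat.cast_nonneg (α := ℝ) d]

/-- A standard Gaussian vector is a good initialisation with probability at least
`L ^ (-1/8) / 8`. -/
theorem exp_le_stdGaussian_goodCone [NeZero k] (hL : 1 ≤ L) (hη : 0 < η) (hη1 : η < 1)
    (hτ : 0 ≤ τ) {u : Fin k → EuclideanSpace ℝ (Fin d)} (hu : ∀ i, ‖u i‖ = 1)
    (hinc : ∀ i, i ≠ 0 → |inner ℝ (u i) (u 0)| ≤ τ)
    (hL₁ : 2 * initB k L η τ ≤ initA L η) (hL₂ : τ ≤ initA L η / initC η d) :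
    Real.exp (-(Real.log L / 8)) / 8 ≤
      (stdGaussian (EuclideanSpace ℝ (Fin d))).real (goodCone u 0 τ) := by
  have hA := initA_nonneg hτ hL₁
  have hτ2 := sq_incoherence_le hL hη hη1 hτ hL₁
  have hC := initC_pos (d := d) hη hη1
  rw [le_div_iff₀ hC] at hL₂
  have hτC : τ ^ 2 * initC η d ^ 2 ≤ initA L η ^ 2 := by
    rw [← mul_pow]; gcongr
  -- The radius `31/32 * C₁²` is the largest allowed by `τ² C₁² ≤ A₁²` and `τ² ≤ 1/32`.
  have h := stdGaussian_goodCone_ge (a := initA L η) (R := 31 / 32 * initC η d ^ 2)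
    hu hinc hA hτ (by nlinarith) (Real.sqrt_nonneg _) (by positivity)
    (sqrt_union_level_le hη hη1 hL hτ hL₁) (by nlinarith)
  rw [Fintype.card_fin, exp_union_level hη hη1, finrank_euclideanSpace_fin] at h
  refine le_trans ?_ h
  have hq : 30 / 93 ≤ 1 - (η / 3 + (d : ℝ) / (31 / 32 * initC η d ^ 2)) := by
    linarith [div_initC_sq_le (d := d) hη hη1]
  have hℓ : 0 ≤ Real.log L := Real.log_nonneg (by exact_mod_cast hL)
  have hexp : Real.exp (-(Real.log L / 8)) ≤ Real.exp (-(initA L η + 1) ^ 2 / 2) := by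
    rw [Real.exp_le_exp]
    have := mul_self_le_mul_self (by linarith) (initA_add_one_le (L := L) hη hη1)
    nlinarith [Real.mul_self_sqrt hℓ]
  have hpi : √(2 * Real.pi) ≤ 2.56 := by
    rw [Real.sqrt_le_left (by norm_num)]
    linarith [Real.pi_lt_d2]
  have hpi0 : 0 < √(2 * Real.pi) := by positivity
  calc Real.exp (-(Real.log L / 8)) / 8
      ≤ Real.exp (-(Real.log L / 8)) / 2.56 * (30 / 93) := by
        have := Real.exp_pos (-(Real.log L / 8))
        norm_num
        linarith
    _ ≤ _ := by gcongr

/-- With `M = L ^ (1/8) ≥ 12/η`, a success probability of at least `1 / (8M)` makes the failure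
probability at most `exp (-M⁷/8) ≤ exp (-M) ≤ 1/M ≤ η`. -/
theorem exp_neg_mul_le (hL : 1 ≤ L) (hη : 0 < η) (h8 : 8 * Real.log (12 / η) ≤ Real.log L)
    (hη1 : η < 1) {p : ℝ} (hp : Real.exp (-(Real.log L / 8)) / 8 ≤ p) :
    Real.exp (-(p * L)) ≤ η := by
  have hL' : (0 : ℝ) < L := by exact_mod_cast hL
  set M := Real.exp (Real.log L / 8) with hM
  have hM8 : M ^ 8 = L := by
    rw [hM, ← Real.exp_nat_mul, show ((8 : ℕ) : ℝ) * (Real.log L / 8) = Real.log L by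
      push_cast; ring, Real.exp_log hL']
  have hMη : 12 / η ≤ M := by
    rw [hM, ← Real.log_le_iff_le_exp (by positivity)]
    linarith
  have hM12 : 12 ≤ M := le_trans (by rw [le_div_iff₀ hη]; linarith) hMη
  have hM0 : 0 < M := by linarith
  have hpL : M ≤ p * L := by
    have h1 : M⁻¹ / 8 * M ^ 8 ≤ p * L := by
      rw [hM8, hM, ← Real.exp_neg]
      gcongr
    refine le_trans ?_ h1
    have h2 : M⁻¹ / 8 * M ^ 8 = M * (M ^ 6 / 8) := by field_simp
    have h3 : 12 ^ 6 ≤ M ^ 6 := by gcongr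
    rw [h2]
    exact le_mul_of_one_le_right hM0.le (by linarith)
  have hηM : 12 ≤ M * η := (div_le_iff₀ hη).1 hMη
  calc Real.exp (-(p * L)) ≤ Real.exp (-M) := by gcongr
    _ = (Real.exp M)⁻¹ := Real.exp_neg M
    _ ≤ M⁻¹ := by gcongr; linarith [Real.add_one_le_exp M]
    _ ≤ η := by rw [inv_le_iff_one_le_mul₀ hM0]; linarith

end InitializationBounds

/-! ### Existence of a good initialisation -/

theorem mainTheorem4 (d k L : ℕ) [NeZero k] (hL : 1 ≤ L) (η τ : ℝ) (hη : 0 < η)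
    -- unit components (the index `0 : Fin k` stands for the first one), incoherent with constant τ
    (u : Fin k → EuclideanSpace ℝ (Fin d))
    (hu_norm : ∀ i, ‖u i‖ = 1)
    (hu_inc : ∀ i j, i ≠ j → |inner ℝ (u i) (u j)| < τ)
    -- the two conditions on `L`
    (hL₁ : 2 * initB k L η τ ≤ initA L η)
    (hL₂ : τ ≤ initA L η / initC η d)
    -- `L` independent uniform samples from the unit sphere
    {Ω : Type*} [MeasurableSpace Ω] (P : Measure Ω) [IsProbabilityMeasure P]
    (v : Fin L → Ω → UnitSphere d)
    (hv_unif : ∀ l, HasLaw (v l) (uniformSphere d) P)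
    (hv_indep : iIndepFun v P) :
    1 - η ≤ P.real {ω | ∃ l : Fin L,
      (∀ i : Fin k, i ≠ 0 →
        2 * |inner ℝ (v l ω : EuclideanSpace ℝ (Fin d)) (u i)|
          ≤ |inner ℝ (v l ω : EuclideanSpace ℝ (Fin d)) (u 0)|) ∧
      τ ≤ |inner ℝ (v l ω : EuclideanSpace ℝ (Fin d)) (u 0)|} := by
  rcases le_or_gt 1 η with hη1 | hη1
  · exact (sub_nonpos.2 hη1).trans measureReal_nonneg
  have hset : {ω | ∃ l : Fin L,
      (∀ i : Fin k, i ≠ 0 →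
        2 * |inner ℝ (v l ω : EuclideanSpace ℝ (Fin d)) (u i)|
          ≤ |inner ℝ (v l ω : EuclideanSpace ℝ (Fin d)) (u 0)|) ∧
      τ ≤ |inner ℝ (v l ω : EuclideanSpace ℝ (Fin d)) (u 0)|} =
      {ω | ∃ l, v l ω ∈ ((↑) ⁻¹' goodCone u 0 τ : Set (UnitSphere d))} := by
    simp [goodCone]
  rcases lt_or_ge τ 0 with hτ | hτ
  · -- A negative bound on the incoherence leaves a single component, and every sample is good.
    have huniv : {ω | ∃ l, v l ω ∈ ((↑) ⁻¹' goodCone u 0 τ : Set (UnitSphere d))} = Set.univ := by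
      refine Set.eq_univ_of_forall fun ω => ⟨⟨0, hL⟩, fun i hi => ?_, ?_⟩
      · exact absurd ((abs_nonneg _).trans_lt (hu_inc i 0 hi)) hτ.not_gt
      · exact (mul_nonpos_of_nonpos_of_nonneg hτ.le (norm_nonneg _)).trans (abs_nonneg _)
    rw [hset, huniv, probReal_univ]
    linarith
  have hd : d ≠ 0 := by
    rintro rfl
    have := hu_norm 0
    rw [Subsingleton.elim (u 0) 0, norm_zero] at this
    exact zero_ne_one this
  have hG := measurableSet_goodCone u 0 τ
  have hp : Real.exp (-(Real.log L / 8)) / 8 ≤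
      (uniformSphere d).real ((↑) ⁻¹' goodCone u 0 τ) := by
    rw [measureReal_def, uniformSphere_apply_cone hd hG (smul_mem_goodCone_iff u 0 τ)]
    exact exp_le_stdGaussian_goodCone hL hη hη1 hτ hu_norm (fun i hi => (hu_inc i 0 hi).le)
      hL₁ hL₂
  have h8 := eight_mul_log_twelve_div_le hL hη hη1 (initA_nonneg hτ hL₁)
  rw [hset]
  have := one_sub_exp_le_measureReal_exists_mem hv_unif hv_indep (measurable_subtype_coe hG)
  linarith [exp_neg_mul_le hL hη h8 hη1 hp]
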